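/- Let $X$ be a compact metric space, $T\colon X\to X$ a homeomorphism, $\mu$ a $T$-invariant Borel probability measure on $X$ (that is, $\mu\in\mathcal M_T(X)$), and $\Xi\subseteq\mathbb S^1=\{z\in\mathbb C:|z|=1\}$. Write $C(X)$ for the space of continuous functions $X\to\mathbb C$ with the supremum norm. For $f\in C(X)$, $\xi\in\mathbb S^1$, $x\in X$ and $n\ge 1$ put $$\mathrm{Av}_n[f,\bar\xi](x)=\frac1n\sum_{j=0}^{n-1}\xi^{-j}f(T^jx),\qquad \mathrm{Av}[f,\bar\xi](x)=\lim_{n\to\infty}\mathrm{Av}_n[f,\bar\xi](x)$$ whenever the limit exists. A point $x$ is *$\mu$-generic* if $\frac1n\sum_{j=0}^{n-1}f(T^jx)\to\int f\,d\mu$ for every $f\in C(X)$. It is *Wiener–Wintner $\mu$-generic* if it is $\mu$-generic and $\mathrm{Av}[f,\bar\xi](x)$ exists for all $f\in C(X)$ and all $\xi\in\mathbb S^1$. The set of frequencies of $x$ is $$\mathrm{Freq}(x)=\{\xi\in\mathbb S^1:\ \limsup_{n\to\infty}|\mathrm{Av}_n[f,\bar\xi](x)|>0\text{ for some }f\in C(X)\}.$$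 Let $U_T g=g\circ T$ be the Koopman operator on $L^2(X,\mu)$, let $\mathrm{Spec}(X,T,\mu)\subseteq\mathbb S^1$ be the set of its eigenvalues, and let $P_{\mathcal K}$ be the orthogonal projection of $L^2(X,\mu)$ onto the closed linear span $\mathcal K$ of its eigenfunctions. The measure $\mu$ has *discrete spectrum* if the linear span of the eigenfunctions of $U_T$ is dense in $L^2(X,\mu)$. A Wiener–Wintner $\mu$-generic point $x$ is *regular* if $\|P_{\mathcal K}f\|_2^2=\sum_{\xi\in\mathrm{Freq}(x)}|\mathrm{Av}[f,\bar\xi](x)|^2$ for every $f\in C(X)$. Then the following conditions are equivalent: 1. $\mu$ is ergodic, has discrete spectrum, and $\mathrm{Spec}(X,T,\mu)\subseteq\Xi$. 2. There is a Borel set $X'\subseteq X$ with $\mu(X')=1$ such that every $x\in X'$ is a regular Wiener–Wintner $\mu$-generic point and, for every $f\in C(X)$, $$\int|f|^2\,d\mu=\sum_{\xi\in\Xi}|\mathrm{Av}[f,\bar\xi](x)|^2.\qquad(*)$$ 3. There are a $\mu$-generic point $x\in X$ and a countable dense set $\mathcal D\subseteq C(X)$ such that for every $f\in\mathcal D$ the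 limit $\mathrm{Av}[f,\bar\xi](x)$ exists for every $\xi\in\Xi$ and $(*)$ holds. 4. There is a regular Wiener–Wintner $\mu$-generic point $x\in X$ such that $(*)$ holds for every $f\in C(X)$ and $\mathrm{Freq}(x)\subseteq\Xi$. -/

import Mathlib

open MeasureTheory Filter Topology

noncomputable section

namespace WienerWintner

section Averages

variable {X : Type*} [TopologicalSpace X]

/-- The weighted ergodic average `(1/n) ∑_{j<n} ξ^{-j} f(T^j x)`. -/
def avg (T : X ≃ₜ X) (f : C(X, ℂ)) (ξ : Circle) (x : X) (n : ℕ) : ℂ :=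
  (n : ℂ)⁻¹ * ∑ j ∈ Finset.range n, (ξ : ℂ) ^ (-(j : ℤ)) * f (T^[j] x)

/-- The sequence of averages of `f` at `x` with respect to `ξ` converges. -/
def AvExists (T : X ≃ₜ X) (f : C(X, ℂ)) (ξ : Circle) (x : X) : Prop :=
  ∃ a : ℂ, Tendsto (avg T f ξ x) atTop (𝓝 a)

/-- The limit of the averages of `f` at `x` with respect to `ξ`; it is meaningful only under
`AvExists T f ξ x`. -/
def av (T : X ≃ₜ X) (f : C(X, ℂ)) (ξ : Circle) (x : X) : ℂ :=
  limUnder atTop (avg T f ξ x)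

/-- The frequencies of a point `x`. Since `f` is bounded, so are the averages, and the
real-valued `limsup` is the usual one. -/
def freq (T : X ≃ₜ X) (x : X) : Set Circle :=
  {ξ | ∃ f : C(X, ℂ), 0 < limsup (fun n => ‖avg T f ξ x n‖) atTop}

variable [MeasurableSpace X]

/-- `x` is a generic point for `μ`. -/
def IsGeneric (T : X ≃ₜ X) (μ : Measure X) (x : X) : Prop :=
  ∀ f : C(X, ℂ), Tendsto (fun n => birkhoffAverage ℂ T f n x) atTop (𝓝 (∫ y, f y ∂μ))

/-- `x` is a Wiener--Wintner generic point for `μ`. -/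
def IsWWGeneric (T : X ≃ₜ X) (μ : Measure X) (x : X) : Prop :=
  IsGeneric T μ x ∧ ∀ (f : C(X, ℂ)) (ξ : Circle), AvExists T f ξ x

end Averages

section Koopman

variable {X : Type*} [MeasurableSpace X] {μ : Measure X} {T : X → X}

/-- The Koopman operator `g ↦ g ∘ T` on `L²(X, μ)`. -/
def koopman (hT : MeasurePreserving T μ μ) : Lp ℂ 2 μ →ₗ[ℂ] Lp ℂ 2 μ :=
  (Lp.compMeasurePreservingₗᵢ ℂ T hT).toLinearMap

/-- The spectrum of `(X, T, μ)`: the set of all eigenvalues of the Koopman operator (which,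
that operator being isometric, lie on the unit circle). -/
def spec (hT : MeasurePreserving T μ μ) : Set Circle :=
  {ξ | Module.End.HasEigenvalue (koopman hT) (ξ : ℂ)}

/-- The linear span of the eigenfunctions of the Koopman operator. -/
def eigenSpan (hT : MeasurePreserving T μ μ) : Submodule ℂ (Lp ℂ 2 μ) :=
  Submodule.span ℂ {g | ∃ c : ℂ, Module.End.HasEigenvector (koopman hT) c g}

/-- The system has discrete (pure-point) spectrum. -/
def HasDiscreteSpectrum (hT : MeasurePreserving T μ μ) : Prop :=
  Dense (eigenSpan hT : Set (Lp ℂ 2 μ))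

/-- The closed linear subspace of `L²(X, μ)` spanned by the eigenfunctions. -/
def kronecker (hT : MeasurePreserving T μ μ) : Submodule ℂ (Lp ℂ 2 μ) :=
  (eigenSpan hT).topologicalClosure

instance kronecker_hasOrthogonalProjection (hT : MeasurePreserving T μ μ) :
    (kronecker hT).HasOrthogonalProjection := by
  unfold kronecker
  infer_instance

end Koopman

/-- A Wiener--Wintner generic point `x` for `μ` is regular if, for every continuous `f`, the
squared norm of the orthogonal projection of `f` onto the closed span of the eigenfunctions is
the sum over the frequencies of `x` of the squared absolute values of the limits of averages. -/
def IsRegularWWGeneric {X : Type*} [MetricSpace X] [CompactSpace X] [MeasurableSpace X]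
    [BorelSpace X] (T : X ≃ₜ X) (μ : Measure X) [IsProbabilityMeasure μ]
    (hT : MeasurePreserving T μ μ) (x : X) : Prop :=
  IsWWGeneric T μ x ∧
    ∀ f : C(X, ℂ), HasSum (fun ξ : freq T x => ‖av T f (ξ : Circle) x‖ ^ 2)
      (‖(kronecker hT).starProjection (ContinuousMap.toLp (E := ℂ) 2 μ ℂ f)‖ ^ 2)

end WienerWintner

end

open WienerWintner

/-! From (1) to (2): ergodicity makes eigenvalues simple and eigenfunctions of constant modulus, so
discrete spectrum gives an orthonormal basis `φ ξ` of unimodular eigenfunctions. Approximate `f` in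
L², hence in L¹, by a finite combination of them. Birkhoff's theorem, of which only the upper bound
is needed, keeps the error small along almost every orbit, uniformly in the frequency. On the
combination the weighted averages are geometric sums. Thus at almost every `x`, for all `f` and `ξ`
at once, the limit is `⟪φ ξ, f⟫ * φ ξ x`, or zero off the spectrum (`ae_tendsto_avg_eigenCoeff`),
and (*) is Parseval's identity since `‖φ ξ x‖ = 1`.

From (3) to (1): at a generic point the limit functional is bounded by the L¹ norm, hence by the L²
norm. Riesz represents it by a vector `φ ξ` of norm at most 1 with `U φ ξ = ξ φ ξ`
(`exists_koopman_eq_smul_inner_toLp`). These vectors are mutually orthogonal, and (*) is equality in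
Bessel's inequality, so they span a dense subspace. Discrete spectrum follows. An eigenfunction
whose eigenvalue is outside `Ξ` is orthogonal to all of them, hence zero, and invariant functions
are multiples of `φ 1`, which is ergodicity.

From (2) to (4), a frequency outside `Ξ` would make the regularity sum exceed `‖f‖²`. -/

namespace WienerWintner

/-! ### The upper half of the pointwise ergodic theorem. -/

section Birkhoff

variable {α : Type*}

/-- The maximum of the first Birkhoff sums `0, S₁, …, Sₙ` of `h`, defined by recursion. -/
def maxBirkhoffSum (T : α → α) (h : α → ℝ) : ℕ → α → ℝ
  | 0, _ => 0
  | n + 1, x => max 0 (h x + maxBirkhoffSum T h n (T x))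

lemma maxBirkhoffSum_nonneg (T : α → α) (h : α → ℝ) (n : ℕ) (x : α) :
    0 ≤ maxBirkhoffSum T h n x := by
  cases n with
  | zero => exact le_rfl
  | succ n => exact le_max_left _ _

lemma maxBirkhoffSum_le_succ (T : α → α) (h : α → ℝ) (n : ℕ) (x : α) :
    maxBirkhoffSum T h n x ≤ maxBirkhoffSum T h (n + 1) x := by
  induction n generalizing x with
  | zero => exact maxBirkhoffSum_nonneg T h 1 x
  | succ n ih => exact max_le_max le_rfl (add_le_add le_rfl (ih (T x)))

lemma monotone_maxBirkhoffSum (T : α → α) (h : α → ℝ) (x : α) :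
    Monotone fun n => maxBirkhoffSum T h n x :=
  monotone_nat_of_le_succ fun n => maxBirkhoffSum_le_succ T h n x

lemma birkhoffSum_le_maxBirkhoffSum (T : α → α) (h : α → ℝ) (n : ℕ) (x : α) :
    birkhoffSum T h n x ≤ maxBirkhoffSum T h n x := by
  induction n generalizing x with
  | zero => simp [maxBirkhoffSum]
  | succ n ih =>
    rw [birkhoffSum_succ']
    exact le_max_of_le_right (add_le_add le_rfl (ih (T x)))

/-- Since `S_{n+1}(x) = h x + S_n(T x)`, the set of points with bounded sums is strictly invariant,
ready for the zero-one law. -/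
lemma bddAbove_birkhoffSum_apply_iff (T : α → α) (h : α → ℝ) (x : α) :
    BddAbove (Set.range fun n => birkhoffSum T h n (T x)) ↔
      BddAbove (Set.range fun n => birkhoffSum T h n x) := by
  constructor
  · rintro ⟨C, hC⟩
    refine ⟨max 0 (h x + C), ?_⟩
    rintro _ ⟨n, rfl⟩
    cases n with
    | zero => simp
    | succ n =>
      dsimp only
      rw [birkhoffSum_succ']
      exact le_max_of_le_right (add_le_add le_rfl (hC ⟨n, rfl⟩))
  · rintro ⟨C, hC⟩
    refine ⟨C - h x, ?_⟩
    rintro _ ⟨n, rfl⟩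
    have := hC ⟨n + 1, rfl⟩
    dsimp only at this ⊢
    rw [birkhoffSum_succ'] at this
    linarith

lemma tendsto_maxBirkhoffSum_atTop {T : α → α} {h : α → ℝ} {x : α}
    (hx : ¬ BddAbove (Set.range fun n => birkhoffSum T h n x)) :
    Tendsto (fun n => maxBirkhoffSum T h n x) atTop atTop := by
  refine tendsto_atTop_atTop_of_monotone (monotone_maxBirkhoffSum T h x) fun b => ?_
  rw [not_bddAbove_iff] at hx
  obtain ⟨_, ⟨n, rfl⟩, hn⟩ := hx b
  exact ⟨n, hn.le.trans (birkhoffSum_le_maxBirkhoffSum T h n x)⟩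

variable [MeasurableSpace α] {μ : Measure α} {T : α → α} {h : α → ℝ}

lemma measurable_birkhoffSum (hT : Measurable T) (hh : Measurable h) (n : ℕ) :
    Measurable (birkhoffSum T h n) := by
  unfold birkhoffSum
  exact Finset.measurable_sum _ fun i _ => hh.comp (hT.iterate i)

lemma integrable_maxBirkhoffSum (hT : MeasurePreserving T μ μ) (hh : Integrable h μ) (n : ℕ) :
    Integrable (maxBirkhoffSum T h n) μ := by
  induction n with
  | zero => exact integrable_zero _ _ _
  | succ n ih => exact (integrable_zero _ _ _).sup (hh.add (hT.integrable_comp_of_integrable ih))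

/-- For an ergodic map, the Birkhoff sums of a function of negative integral are almost everywhere
bounded above. -/
theorem _root_.Ergodic.ae_bddAbove_birkhoffSum (hT : Ergodic T μ) (hm : Measurable h)
    (hh : Integrable h μ) (hneg : ∫ x, h x ∂μ < 0) :
    ∀ᵐ x ∂μ, BddAbove (Set.range fun n => birkhoffSum T h n x) := by
  have hTm := hT.toMeasurePreserving
  set B : Set α := {x | BddAbove (Set.range fun n => birkhoffSum T h n x)} with hB
  have hBm : MeasurableSet B := by
    have : B = ⋃ C : ℕ, ⋂ n : ℕ, {x | birkhoffSum T h n x ≤ C} := by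
      ext x
      simp only [hB, Set.mem_ofPred_eq, Set.mem_iUnion, Set.mem_iInter]
      constructor
      · rintro ⟨C, hC⟩
        obtain ⟨N, hN⟩ := exists_nat_ge C
        exact ⟨N, fun n => (hC ⟨n, rfl⟩).trans hN⟩
      · rintro ⟨C, hC⟩
        exact ⟨C, by rintro _ ⟨n, rfl⟩; exact hC n⟩
    rw [this]
    exact MeasurableSet.iUnion fun C => MeasurableSet.iInter fun n =>
      measurableSet_le (measurable_birkhoffSum hTm.measurable hm n) measurable_const
  have hBinv : T ⁻¹' B = B := by
    ext x
    exact bddAbove_birkhoffSum_apply_iff T h x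
  rcases hT.toPreErgodic.ae_mem_or_ae_notMem hBm hBinv with hall | hnone
  · exact hall
  · exfalso
    have hMT : ∀ n, Integrable (fun x => maxBirkhoffSum T h n (T x)) μ := fun n =>
      hTm.integrable_comp_of_integrable (integrable_maxBirkhoffSum hTm hh n)
    -- The integrand is `max (-M_n(T x)) (h x)`, dominated by `|h|`; it equals `h x` once `M_n(T x)`
    -- is large. By invariance of `μ` its integral is that of `M_{n+1} - M_n ≥ 0`, so `∫ h ≥ 0`, a
    -- contradiction.
    have hlim : Tendsto (fun n => ∫ x, (maxBirkhoffSum T h (n + 1) x - maxBirkhoffSum T h n (T x)) ∂μ)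
        atTop (𝓝 (∫ x, h x ∂μ)) := by
      refine tendsto_integral_of_dominated_convergence (fun x => |h x|)
        (fun n => ((integrable_maxBirkhoffSum hTm hh (n + 1)).sub (hMT n)).aestronglyMeasurable)
        hh.abs (fun n => Eventually.of_forall fun x => ?_) ?_
      · have h0 := maxBirkhoffSum_nonneg T h n (T x)
        rw [Real.norm_eq_abs, maxBirkhoffSum]
        rcases max_cases 0 (h x + maxBirkhoffSum T h n (T x)) with ⟨e, h1⟩ | ⟨e, h1⟩ <;> rw [e]
        · rw [abs_le]
          constructor <;> cases abs_cases (h x) <;> linarith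
        · simp
      · filter_upwards [hnone] with x hx
        have hx' : ¬ BddAbove (Set.range fun n => birkhoffSum T h n (T x)) :=
          fun hb => hx ((bddAbove_birkhoffSum_apply_iff T h x).1 hb)
        refine tendsto_const_nhds.congr' ?_
        filter_upwards [(tendsto_maxBirkhoffSum_atTop hx').eventually_ge_atTop (-h x)] with n hn
        rw [maxBirkhoffSum, max_eq_right (by linarith)]
        ring
    have hnn : ∀ n, 0 ≤ ∫ x, (maxBirkhoffSum T h (n + 1) x - maxBirkhoffSum T h n (T x)) ∂μ := by
      intro n
      rw [integral_sub (integrable_maxBirkhoffSum hTm hh (n + 1)) (hMT n), sub_nonneg]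
      have : ∫ x, maxBirkhoffSum T h n (T x) ∂μ = ∫ x, maxBirkhoffSum T h n x ∂μ := by
        have := integral_map (μ := μ) (φ := T) (f := maxBirkhoffSum T h n) hTm.measurable.aemeasurable
          (by rw [hTm.map_eq]; exact (integrable_maxBirkhoffSum hTm hh n).aestronglyMeasurable)
        rw [hTm.map_eq] at this
        exact this.symm
      rw [this]
      exact integral_mono (integrable_maxBirkhoffSum hTm hh n)
        (integrable_maxBirkhoffSum hTm hh (n + 1)) (maxBirkhoffSum_le_succ T h n)
    exact absurd (ge_of_tendsto' hlim hnn) (not_le.2 hneg)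

/-- The upper half of Birkhoff's pointwise ergodic theorem for ergodic maps. -/
theorem _root_.Ergodic.ae_eventually_birkhoffAverage_le [IsProbabilityMeasure μ]
    (hT : Ergodic T μ) (hm : Measurable h) (hh : Integrable h μ) :
    ∀ᵐ x ∂μ, ∀ a : ℝ, ∫ y, h y ∂μ < a → ∀ᶠ n in atTop, birkhoffAverage ℝ T h n x ≤ a := by
  -- For rational `q` above the integral, the sums of `h - q` are bounded by some `C`, so the
  -- averages of `h` are at most `q + C / n`. Countability of the `q` leaves one null set for every
  -- `a`.
  have key : ∀ q : ℚ, ∀ᵐ x ∂μ, ∫ y, h y ∂μ < q →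
      BddAbove (Set.range fun n => birkhoffSum T (fun y => h y - q) n x) := by
    intro q
    by_cases hq : ∫ y, h y ∂μ < q
    · have := hT.ae_bddAbove_birkhoffSum (hm.sub_const (q : ℝ)) (hh.sub (integrable_const _))
        (by rw [integral_sub hh (integrable_const _)]; simpa using hq)
      filter_upwards [this] with x hx _ using hx
    · exact Eventually.of_forall fun x hx => absurd hx hq
  filter_upwards [ae_all_iff.2 key] with x hx a ha
  obtain ⟨q, hq, hqa⟩ := exists_rat_btwn ha
  obtain ⟨C, hC⟩ := hx q hq
  have hlim : Tendsto (fun n : ℕ => C / n) atTop (𝓝 0) := tendsto_const_div_atTop_nhds_zero_nat C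
  filter_upwards [hlim.eventually_le_const (sub_pos.2 hqa), eventually_gt_atTop 0] with n hn hn0
  have hn' : (0 : ℝ) < n := by exact_mod_cast hn0
  have h1 : birkhoffSum T (fun y => h y - q) n x ≤ C := hC ⟨n, rfl⟩
  have h2 : birkhoffSum T (fun y => h y - q) n x = birkhoffSum T h n x - n * q := by
    simp [birkhoffSum, Finset.sum_sub_distrib]
  rw [h2] at h1
  rw [div_le_iff₀ hn'] at hn
  rw [birkhoffAverage, smul_eq_mul, inv_mul_le_iff₀ hn']
  linarith

end Birkhoff

/-! ### Weighted averages: approximation and geometric sums. -/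

section WeightedAverages

variable {X : Type*}

/-- The weighted ergodic average of an arbitrary function. -/
noncomputable def wavg (T : X → X) (f : X → ℂ) (ξ : Circle) (x : X) (n : ℕ) : ℂ :=
  (n : ℂ)⁻¹ * ∑ j ∈ Finset.range n, (ξ : ℂ) ^ (-(j : ℤ)) * f (T^[j] x)

variable (T : X → X) (f g : X → ℂ) (ξ : Circle) (x : X)

lemma wavg_add (n : ℕ) :
    wavg T (fun y => f y + g y) ξ x n = wavg T f ξ x n + wavg T g ξ x n := by
  simp only [wavg, mul_add, Finset.sum_add_distrib]

lemma wavg_const_mul (c : ℂ) (n : ℕ) :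
    wavg T (fun y => c * f y) ξ x n = c * wavg T f ξ x n := by
  simp only [wavg, Finset.mul_sum]
  exact Finset.sum_congr rfl fun j _ => by ring

lemma wavg_sum {ι : Type*} (s : Finset ι) (F : ι → X → ℂ) (n : ℕ) :
    wavg T (fun y => ∑ i ∈ s, F i y) ξ x n = ∑ i ∈ s, wavg T (F i) ξ x n := by
  simp only [wavg, Finset.mul_sum]
  exact Finset.sum_comm

/-- The bound does not involve `ξ`; this is what lets a single null set serve all frequencies. -/
lemma norm_wavg_sub_le (n : ℕ) :
    ‖wavg T f ξ x n - wavg T g ξ x n‖ ≤ birkhoffAverage ℝ T (fun y => ‖f y - g y‖) n x := by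
  have : wavg T f ξ x n - wavg T g ξ x n =
      (n : ℂ)⁻¹ * ∑ j ∈ Finset.range n, (ξ : ℂ) ^ (-(j : ℤ)) * (f (T^[j] x) - g (T^[j] x)) := by
    simp only [wavg, mul_sub, Finset.sum_sub_distrib]
  rw [this, birkhoffAverage, birkhoffSum, norm_mul, norm_inv, Complex.norm_natCast, smul_eq_mul]
  refine mul_le_mul_of_nonneg_left ((norm_sum_le _ _).trans_eq ?_) (by positivity)
  refine Finset.sum_congr rfl fun j _ => ?_
  rw [norm_mul, norm_zpow, Circle.norm_coe, one_zpow, one_mul]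

lemma norm_wavg_le (n : ℕ) :
    ‖wavg T f ξ x n‖ ≤ birkhoffAverage ℝ T (fun y => ‖f y‖) n x := by
  have h := norm_wavg_sub_le T f (fun _ => 0) ξ x n
  have h0 : wavg T (fun _ : X => (0 : ℂ)) ξ x n = 0 := by simp [wavg]
  simpa [h0] using h

lemma birkhoffAverage_le_of_le {h : X → ℝ} {C : ℝ} (hC : 0 ≤ C) (hh : ∀ y, h y ≤ C) (n : ℕ) :
    birkhoffAverage ℝ T h n x ≤ C := by
  rcases Nat.eq_zero_or_pos n with rfl | hn
  · simpa using hC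
  · rw [birkhoffAverage, smul_eq_mul, inv_mul_le_iff₀ (by exact_mod_cast hn), birkhoffSum]
    calc ∑ k ∈ Finset.range n, h (T^[k] x) ≤ ∑ _k ∈ Finset.range n, C :=
          Finset.sum_le_sum fun k _ => hh _
      _ = n * C := by simp

variable {T f ξ x}

lemma exists_tendsto_wavg_of_approx
    (H : ∀ ε > 0, ∃ g : X → ℂ, (∃ a, Tendsto (wavg T g ξ x) atTop (𝓝 a)) ∧
      ∀ᶠ n in atTop, birkhoffAverage ℝ T (fun y => ‖f y - g y‖) n x ≤ ε) :
    ∃ a, Tendsto (wavg T f ξ x) atTop (𝓝 a) := by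
  refine cauchySeq_tendsto_of_complete (Metric.cauchySeq_iff'.2 fun ε hε => ?_)
  obtain ⟨g, ⟨a, ha⟩, hg⟩ := H (ε / 4) (by positivity)
  obtain ⟨N, hN⟩ := eventually_atTop.1
    (hg.and (Metric.tendsto_nhds.1 ha (ε / 4) (by positivity)))
  refine ⟨N, fun n hn => ?_⟩
  have key : ∀ m ≥ N, dist (wavg T f ξ x m) a < ε / 2 := fun m hm => by
    obtain ⟨h1, h2⟩ := hN m hm
    calc dist (wavg T f ξ x m) a
        ≤ dist (wavg T f ξ x m) (wavg T g ξ x m) + dist (wavg T g ξ x m) a := dist_triangle _ _ _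
      _ < ε / 4 + ε / 4 := by
          refine add_lt_add_of_le_of_lt ?_ h2
          rw [dist_eq_norm]
          exact (norm_wavg_sub_le T f g ξ x m).trans h1
      _ = ε / 2 := by ring
  calc dist (wavg T f ξ x n) (wavg T f ξ x N)
      ≤ dist (wavg T f ξ x n) a + dist (wavg T f ξ x N) a := dist_triangle_right _ _ _
    _ < ε := by linarith [key n hn, key N le_rfl]

lemma tendsto_wavg_of_approx {l : ℂ}
    (H : ∀ ε > 0, ∃ (g : X → ℂ) (a : ℂ), Tendsto (wavg T g ξ x) atTop (𝓝 a) ∧ ‖a - l‖ ≤ ε ∧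
      ∀ᶠ n in atTop, birkhoffAverage ℝ T (fun y => ‖f y - g y‖) n x ≤ ε) :
    Tendsto (wavg T f ξ x) atTop (𝓝 l) := by
  refine Metric.tendsto_nhds.2 fun ε hε => ?_
  obtain ⟨g, a, ha, hal, hg⟩ := H (ε / 4) (by positivity)
  filter_upwards [hg, Metric.tendsto_nhds.1 ha (ε / 4) (by positivity)] with n h1 h2
  have h3 := (norm_wavg_sub_le T f g ξ x n).trans h1
  rw [← dist_eq_norm] at h3 hal
  linarith [dist_triangle4 (wavg T f ξ x n) (wavg T g ξ x n) a l]

open Classical in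
/-- Along an orbit on which `φ` behaves as an eigenfunction, the weighted averages of `φ` pick out
the eigenvalue. -/
lemma tendsto_wavg_of_eigen {φ : X → ℂ} {ζ : Circle}
    (hφ : ∀ j : ℕ, φ (T^[j] x) = (ζ : ℂ) ^ j * φ x) :
    Tendsto (wavg T φ ξ x) atTop (𝓝 (if ζ = ξ then φ x else 0)) := by
  have hw : ∀ n, wavg T φ ξ x n =
      (n : ℂ)⁻¹ * ((∑ j ∈ Finset.range n, ((ζ / ξ : Circle) : ℂ) ^ j) * φ x) := fun n => by
    rw [wavg, Finset.sum_mul]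
    congr 1
    refine Finset.sum_congr rfl fun j _ => ?_
    rw [hφ, Circle.coe_div, div_pow, zpow_neg, zpow_natCast]
    ring
  split_ifs with h
  · subst h
    refine tendsto_const_nhds.congr' ?_
    filter_upwards [eventually_gt_atTop 0] with n hn
    have : (n : ℂ) ≠ 0 := by exact_mod_cast hn.ne'
    rw [hw]
    simp [this]
  · have hne : ((ζ / ξ : Circle) : ℂ) ≠ 1 := fun h1 =>
      h (div_eq_one.1 (Circle.coe_injective (by simpa using h1)))
    -- A geometric sum of unimodular ratio `r ≠ 1` is bounded by `2 / ‖r - 1‖`.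
    refine squeeze_zero_norm (a := fun n : ℕ =>
      (2 / ‖((ζ / ξ : Circle) : ℂ) - 1‖ * ‖φ x‖) / n) (fun n => ?_)
      (tendsto_const_div_atTop_nhds_zero_nat _)
    rw [hw, geom_sum_eq hne, norm_mul, norm_mul, norm_div, norm_inv, Complex.norm_natCast,
      div_eq_inv_mul _ (n : ℝ)]
    gcongr
    refine (norm_sub_le _ _).trans ?_
    rw [norm_pow, Circle.norm_coe]
    norm_num

end WeightedAverages

/-! ### Averages of continuous functions at a generic point. -/

section Continuous

variable {X : Type*} [TopologicalSpace X] {T : X ≃ₜ X} {x : X}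

lemma avg_one (f : C(X, ℂ)) (x : X) (n : ℕ) : avg T f 1 x n = birkhoffAverage ℂ T f n x := by
  simp [avg, birkhoffAverage, birkhoffSum]

lemma AvExists.tendsto {f : C(X, ℂ)} {ξ : Circle} (h : AvExists T f ξ x) :
    Tendsto (avg T f ξ x) atTop (𝓝 (av T f ξ x)) :=
  tendsto_nhds_limUnder h

lemma mem_freq_iff {ξ : Circle} (h : ∀ f : C(X, ℂ), AvExists T f ξ x) :
    ξ ∈ freq T x ↔ ∃ f : C(X, ℂ), av T f ξ x ≠ 0 := by
  have : ∀ f : C(X, ℂ), limsup (fun n => ‖avg T f ξ x n‖) atTop = ‖av T f ξ x‖ :=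
    fun f => (h f).tendsto.norm.limsup_eq
  simp [freq, this]

lemma avExists_of_dense [CompactSpace X] {D : Set C(X, ℂ)} (hD : Dense D) {ξ : Circle}
    (h : ∀ f ∈ D, AvExists T f ξ x) (f : C(X, ℂ)) : AvExists T f ξ x := by
  refine exists_tendsto_wavg_of_approx fun ε hε => ?_
  obtain ⟨g, hgD, hg⟩ := hD.exists_dist_lt f hε
  refine ⟨g, h g hgD, Eventually.of_forall fun n => ?_⟩
  refine birkhoffAverage_le_of_le _ _ hε.le (fun y => ?_) n
  rw [← dist_eq_norm]
  exact (ContinuousMap.dist_apply_le_dist y).trans hg.le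

variable [MeasurableSpace X] {μ : Measure X}

lemma IsGeneric.tendsto_norm (hx : IsGeneric T μ x) (f : C(X, ℂ)) :
    Tendsto (fun n => birkhoffAverage ℝ T (fun y => ‖f y‖) n x) atTop (𝓝 (∫ y, ‖f y‖ ∂μ)) := by
  have h := hx ⟨fun y => ((‖f y‖ : ℝ) : ℂ), by fun_prop⟩
  have h2 := (Complex.continuous_re.tendsto _).comp h
  simp only [ContinuousMap.coe_mk, integral_complex_ofReal, Complex.ofReal_re] at h2
  refine h2.congr fun n => ?_
  simp only [Function.comp, birkhoffAverage, birkhoffSum, smul_eq_mul]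
  rw [← Complex.ofReal_sum, ← Complex.ofReal_natCast, ← Complex.ofReal_inv, ← Complex.ofReal_mul,
    Complex.ofReal_re]

/-- Genericity is applied to `|f|`, itself continuous. The estimate makes the limit functional
extend to L². -/
lemma IsGeneric.norm_av_le (hx : IsGeneric T μ x) {f : C(X, ℂ)} {ξ : Circle}
    (h : AvExists T f ξ x) : ‖av T f ξ x‖ ≤ ∫ y, ‖f y‖ ∂μ :=
  le_of_tendsto_of_tendsto' h.tendsto.norm (hx.tendsto_norm f) fun n => norm_wavg_le T f ξ x n

end Continuous

/-! ### Norm comparisons in L². -/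

section LTwo

variable {X : Type*} [MeasurableSpace X] {μ : Measure X} [IsProbabilityMeasure μ]

lemma integral_norm_le_norm_Lp (u : Lp ℂ 2 μ) : ∫ y, ‖u y‖ ∂μ ≤ ‖u‖ := by
  have hu := Lp.aestronglyMeasurable u
  rw [integral_norm_eq_lintegral_enorm hu, ← eLpNorm_one_eq_lintegral_enorm, Lp.norm_def]
  exact ENNReal.toReal_mono (Lp.eLpNorm_ne_top u)
    (eLpNorm_le_eLpNorm_of_exponent_le (by norm_num) hu)

variable [TopologicalSpace X] [CompactSpace X] [BorelSpace X]
  [SecondCountableTopologyEither X ℂ]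

lemma integral_norm_le_norm_toLp (f : C(X, ℂ)) :
    ∫ y, ‖f y‖ ∂μ ≤ ‖ContinuousMap.toLp (E := ℂ) 2 μ ℂ f‖ := by
  refine le_trans (le_of_eq (integral_congr_ae ?_)) (integral_norm_le_norm_Lp _)
  filter_upwards [ContinuousMap.coeFn_toLp (p := 2) (𝕜 := ℂ) μ f] with y hy
  rw [hy]

lemma norm_toLp_sq (f : C(X, ℂ)) :
    ‖ContinuousMap.toLp (E := ℂ) 2 μ ℂ f‖ ^ 2 = ∫ y, ‖f y‖ ^ 2 ∂μ := by
  have h := ContinuousMap.inner_toLp (𝕜 := ℂ) μ f f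
  rw [inner_self_eq_norm_sq_to_K] at h
  have h2 : ∀ y, f y * (starRingEnd ℂ) (f y) = ((‖f y‖ ^ 2 : ℝ) : ℂ) := fun y => by
    rw [Complex.mul_conj, Complex.normSq_eq_norm_sq]
  simp only [h2, integral_complex_ofReal] at h
  exact Complex.ofReal_injective (by push_cast; simpa using h)

end LTwo

/-! ### The Koopman isometry and an ergodicity criterion. -/

section Koopman

variable {X : Type*} [MeasurableSpace X] {μ : Measure X} {T : X → X}

lemma norm_koopman (hT : MeasurePreserving T μ μ) (g : Lp ℂ 2 μ) : ‖koopman hT g‖ = ‖g‖ :=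
  (Lp.compMeasurePreservingₗᵢ ℂ T hT).norm_map g

lemma inner_koopman_koopman (hT : MeasurePreserving T μ μ) (g h : Lp ℂ 2 μ) :
    inner ℂ (koopman hT g) (koopman hT h) = inner ℂ g h :=
  (Lp.compMeasurePreservingₗᵢ ℂ T hT).inner_map_map g h

lemma continuous_koopman (hT : MeasurePreserving T μ μ) : Continuous (koopman hT) :=
  (Lp.compMeasurePreservingₗᵢ ℂ T hT).continuous

lemma coeFn_koopman (hT : MeasurePreserving T μ μ) (g : Lp ℂ 2 μ) :
    koopman hT g =ᵐ[μ] g ∘ T :=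
  Lp.coeFn_compMeasurePreserving g hT

lemma norm_eq_one_of_koopman_eq_smul (hT : MeasurePreserving T μ μ) {g : Lp ℂ 2 μ} {c : ℂ}
    (hg : koopman hT g = c • g) (hg0 : g ≠ 0) : ‖c‖ = 1 := by
  have h := norm_koopman hT g
  rw [hg, norm_smul] at h
  exact (mul_eq_right₀ (norm_ne_zero_iff.2 hg0)).1 h

lemma inner_eq_zero_of_koopman_eq_smul (hT : MeasurePreserving T μ μ) {g h : Lp ℂ 2 μ}
    {ξ ζ : Circle} (hg : koopman hT g = (ξ : ℂ) • g) (hh : koopman hT h = (ζ : ℂ) • h)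
    (hne : ξ ≠ ζ) : inner ℂ g h = 0 := by
  have h1 := inner_koopman_koopman hT g h
  rw [hg, hh, inner_smul_left, inner_smul_right, ← Circle.coe_inv_eq_conj, ← mul_assoc,
    ← Circle.coe_mul] at h1
  by_contra h0
  have h2 : ((ξ⁻¹ * ζ : Circle) : ℂ) = 1 := (mul_eq_right₀ h0).1 h1
  exact hne (inv_mul_eq_one.1 (Circle.coe_injective (by simpa using h2)))

/-- If all invariant functions in `L²` are multiples of a single one, the system is ergodic. -/
lemma ergodic_of_invariant_eq_smul [IsProbabilityMeasure μ] (hT : MeasurePreserving T μ μ)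
    {ψ : Lp ℂ 2 μ} (hψ : ∀ u : Lp ℂ 2 μ, koopman hT u = u → ∃ c : ℂ, u = c • ψ) :
    Ergodic T μ := by
  refine ⟨hT, ⟨fun s hs hinv => ?_⟩⟩
  have hind : ∀ (t : Set X) (ht : MeasurableSet t), T ⁻¹' t = t →
      koopman hT (indicatorConstLp 2 ht (measure_ne_top μ t) 1) =
        indicatorConstLp 2 ht (measure_ne_top μ t) 1 := by
    intro t ht htinv
    refine (Lp.ext ?_)
    refine (coeFn_koopman hT _).trans ?_
    have h1 := indicatorConstLp_coeFn (p := 2) (hs := ht) (hμs := measure_ne_top μ t) (c := (1 : ℂ))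
    refine (hT.quasiMeasurePreserving.ae_eq_comp h1).trans (EventuallyEq.trans ?_ h1.symm)
    refine Eventually.of_forall fun y => ?_
    simp only [Function.comp, Set.indicator]
    congr 1
    exact propext (Set.ext_iff.1 htinv y)
  -- From `1 = a ψ` and `1_s = b ψ` comes `a 1_s = b` almost everywhere with `a ≠ 0`, so `1_s` is
  -- constant.
  obtain ⟨a, ha⟩ := hψ _ (hind Set.univ MeasurableSet.univ rfl)
  obtain ⟨b, hb⟩ := hψ _ (hind s hs hinv)
  have h1 := indicatorConstLp_coeFn (p := 2) (hs := MeasurableSet.univ)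
    (hμs := measure_ne_top μ Set.univ) (c := (1 : ℂ))
  have h2 := indicatorConstLp_coeFn (p := 2) (hs := hs)
    (hμs := measure_ne_top μ s) (c := (1 : ℂ))
  rw [ha] at h1
  rw [hb] at h2
  have key : ∀ᵐ y ∂μ, b = a * s.indicator (fun _ => (1 : ℂ)) y := by
    filter_upwards [h1, h2, Lp.coeFn_smul a ψ, Lp.coeFn_smul b ψ] with y e1 e2 e3 e4
    rw [e3] at e1
    rw [e4] at e2
    simp only [Pi.smul_apply, smul_eq_mul, Set.indicator_univ] at e1 e2
    rw [← e2]
    linear_combination (-b) * e1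
  have ha0 : a ≠ 0 := by
    rintro rfl
    have : ∀ᵐ _ ∂μ, False := by
      filter_upwards [h1, Lp.coeFn_smul (0 : ℂ) ψ] with y e1 e3
      rw [e3] at e1
      simp at e1
    exact (NeBot.ne inferInstance (Filter.eventually_false_iff_eq_bot.1 this) : False)
  rw [eventuallyConst_set]
  by_cases hb0 : b = 0
  · right
    filter_upwards [key] with y hy hys
    rw [Set.indicator_of_mem hys, hb0, mul_one] at hy
    exact ha0 hy.symm
  · left
    filter_upwards [key] with y hy
    by_contra hys
    rw [Set.indicator_of_notMem hys, mul_zero] at hy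
    exact hb0 hy

end Koopman

/-! ### Bessel's inequality for orthogonal vectors in the unit ball. -/

section Bessel

variable {ι E : Type*} [NormedAddCommGroup E] [InnerProductSpace ℂ E] {φ : ι → E}

/-- Removing `c • φ a` lowers the squared norm by `2‖c‖² - ‖c‖²‖φ a‖² ≥ ‖c‖²`. Only norm at most 1
is assumed because the Riesz vectors may be short or zero. -/
lemma norm_sub_sum_inner_smul_sq_le (hφ : Pairwise fun i j => inner ℂ (φ i) (φ j) = 0)
    (hφ1 : ∀ i, ‖φ i‖ ≤ 1) (v : E) (s : Finset ι) :
    ‖v - ∑ i ∈ s, inner ℂ (φ i) v • φ i‖ ^ 2 ≤ ‖v‖ ^ 2 - ∑ i ∈ s, ‖inner ℂ (φ i) v‖ ^ 2 := by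
  classical
  induction s using Finset.induction_on with
  | empty => simp
  | insert a s ha ih =>
    rw [Finset.sum_insert ha, Finset.sum_insert ha, add_comm (inner ℂ (φ a) v • φ a), ← sub_sub]
    set w := v - ∑ i ∈ s, inner ℂ (φ i) v • φ i with hw
    have hwa : inner ℂ (φ a) w = inner ℂ (φ a) v := by
      rw [hw, inner_sub_right, inner_sum, Finset.sum_eq_zero, sub_zero]
      intro i hi
      rw [inner_smul_right, hφ (ne_of_mem_of_not_mem hi ha).symm, mul_zero]
    set c := inner ℂ (φ a) v with hc
    have h1 : RCLike.re (inner ℂ w (c • φ a)) = ‖c‖ ^ 2 := by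
      rw [inner_smul_right, ← inner_conj_symm, hwa, Complex.mul_conj, Complex.normSq_eq_norm_sq]
      exact Complex.ofReal_re _
    rw [norm_sub_sq (𝕜 := ℂ), h1, norm_smul, mul_pow]
    have h2 : ‖c‖ ^ 2 * ‖φ a‖ ^ 2 ≤ ‖c‖ ^ 2 * 1 :=
      mul_le_mul_of_nonneg_left (pow_le_one₀ (norm_nonneg _) (hφ1 a)) (by positivity)
    linarith

lemma mem_closure_span_of_hasSum (hφ : Pairwise fun i j => inner ℂ (φ i) (φ j) = 0)
    (hφ1 : ∀ i, ‖φ i‖ ≤ 1) {v : E} (hv : HasSum (fun i => ‖inner ℂ (φ i) v‖ ^ 2) (‖v‖ ^ 2)) :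
    v ∈ closure (Submodule.span ℂ (Set.range φ) : Set E) := by
  have hlim : Tendsto (fun s : Finset ι => ∑ i ∈ s, inner ℂ (φ i) v • φ i) atTop (𝓝 v) := by
    rw [tendsto_iff_norm_sub_tendsto_zero]
    have h0 : Tendsto (fun s : Finset ι => ‖v‖ ^ 2 - ∑ i ∈ s, ‖inner ℂ (φ i) v‖ ^ 2) atTop
        (𝓝 0) := by
      rw [← sub_self (‖v‖ ^ 2)]
      exact tendsto_const_nhds.sub hv
    have h1 := squeeze_zero (fun s => by positivity)
      (norm_sub_sum_inner_smul_sq_le hφ hφ1 v) h0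
    have h2 := (Real.continuous_sqrt.tendsto _).comp h1
    simp only [Function.comp_def, Real.sqrt_zero, Real.sqrt_sq (norm_nonneg _)] at h2
    simpa only [norm_sub_rev] using h2
  refine mem_closure_of_tendsto hlim (Eventually.of_forall fun s => ?_)
  exact Submodule.sum_mem _ fun i _ =>
    Submodule.smul_mem _ _ (Submodule.subset_span (Set.mem_range_self i))

end Bessel

/-! ### The limit functional, its Riesz vector, and (3) implies (1). -/

section Functional

variable {X : Type*} [MetricSpace X] {T : X ≃ₜ X} {x : X} {ξ : Circle}

lemma av_add {f g : C(X, ℂ)} (hf : AvExists T f ξ x) (hg : AvExists T g ξ x) :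
    av T (f + g) ξ x = av T f ξ x + av T g ξ x :=
  ((hf.tendsto.add hg.tendsto).congr fun n => (wavg_add T f g ξ x n).symm).limUnder_eq

lemma av_smul (c : ℂ) {f : C(X, ℂ)} (hf : AvExists T f ξ x) :
    av T (c • f) ξ x = c * av T f ξ x :=
  ((hf.tendsto.const_mul c).congr fun n => (wavg_const_mul T f ξ x c n).symm).limUnder_eq

/-- Reindexing by one step along the orbit telescopes the sum to two boundary terms, which vanish in
the limit. -/
lemma avg_comp_sub (f : C(X, ℂ)) (n : ℕ) :
    avg T (f.comp (T : C(X, X))) ξ x n - ξ * avg T f ξ x n =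
      (n : ℂ)⁻¹ * (ξ * ((ξ : ℂ) ^ (-(n : ℤ)) * f (T^[n] x) - f x)) := by
  have h : ∀ j : ℕ, (ξ : ℂ) ^ (-(j : ℤ)) * (f.comp (T : C(X, X))) (T^[j] x) =
      ξ * ((ξ : ℂ) ^ (-((j + 1 : ℕ) : ℤ)) * f (T^[j + 1] x)) := fun j => by
    have hj : 1 + -((j + 1 : ℕ) : ℤ) = -(j : ℤ) := by push_cast; ring
    rw [Function.iterate_succ_apply', ← mul_assoc, ← zpow_one_add₀ (Circle.coe_ne_zero ξ), hj]
    rfl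
  simp only [avg, h, ← Finset.mul_sum]
  have hs := Finset.sum_range_sub (fun j : ℕ => (ξ : ℂ) ^ (-(j : ℤ)) * f (T^[j] x)) n
  rw [Finset.sum_sub_distrib] at hs
  simp only [Nat.cast_zero, neg_zero, zpow_zero, Function.iterate_zero, id, one_mul] at hs
  rw [← hs]
  ring

variable [CompactSpace X]

lemma av_comp {f : C(X, ℂ)} (hf : AvExists T f ξ x) :
    av T (f.comp (T : C(X, X))) ξ x = ξ * av T f ξ x := by
  refine Tendsto.limUnder_eq ?_
  have h0 : Tendsto (fun n => avg T (f.comp (T : C(X, X))) ξ x n - ξ * avg T f ξ x n) atTop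
      (𝓝 0) := by
    refine squeeze_zero_norm (a := fun n : ℕ => (‖f‖ + ‖f‖) / n) (fun n => ?_)
      (tendsto_const_div_atTop_nhds_zero_nat _)
    rw [avg_comp_sub, norm_mul, norm_mul, norm_inv, Complex.norm_natCast, Circle.norm_coe, one_mul,
      div_eq_inv_mul]
    gcongr
    refine (norm_sub_le _ _).trans (add_le_add ?_ (f.norm_coe_le_norm _))
    rw [norm_mul, norm_zpow, Circle.norm_coe, one_zpow, one_mul]
    exact f.norm_coe_le_norm _
  simpa using h0.add (hf.tendsto.const_mul (ξ : ℂ))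

variable [MeasurableSpace X] [BorelSpace X] {μ : Measure X} [IsProbabilityMeasure μ]

lemma koopman_toLp (hT : MeasurePreserving T μ μ) (f : C(X, ℂ)) :
    koopman hT (ContinuousMap.toLp (E := ℂ) 2 μ ℂ f) =
      ContinuousMap.toLp (E := ℂ) 2 μ ℂ (f.comp (T : C(X, X))) := by
  refine Lp.ext ((coeFn_koopman hT _).trans ?_)
  refine (hT.quasiMeasurePreserving.ae_eq_comp
    (ContinuousMap.coeFn_toLp (p := 2) (𝕜 := ℂ) μ f)).trans ?_
  exact (ContinuousMap.coeFn_toLp (p := 2) (𝕜 := ℂ) μ (f.comp (T : C(X, X)))).symm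

lemma denseRange_toLp : DenseRange (ContinuousMap.toLp (E := ℂ) 2 μ ℂ : C(X, ℂ) → Lp ℂ 2 μ) :=
  ContinuousMap.toLp_denseRange ℂ μ ℂ (by norm_num)

/-- The averages of continuous functions at a generic point are represented by an eigenfunction
(or by zero). -/
theorem exists_koopman_eq_smul_inner_toLp (hT : MeasurePreserving T μ μ) (hx : IsGeneric T μ x)
    (h : ∀ f : C(X, ℂ), AvExists T f ξ x) :
    ∃ φ : Lp ℂ 2 μ, ‖φ‖ ≤ 1 ∧ koopman hT φ = (ξ : ℂ) • φ ∧
      ∀ f : C(X, ℂ), inner ℂ φ (ContinuousMap.toLp (E := ℂ) 2 μ ℂ f) = av T f ξ x := by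
  let A : C(X, ℂ) →ₗ[ℂ] ℂ :=
    { toFun := fun f => av T f ξ x
      map_add' := fun f g => av_add (h f) (h g)
      map_smul' := fun c f => av_smul c (h f) }
  let e : C(X, ℂ) →ₗ[ℂ] Lp ℂ 2 μ := (ContinuousMap.toLp (E := ℂ) 2 μ ℂ).toLinearMap
  have he : DenseRange e := denseRange_toLp
  have hA : ∀ f, ‖A f‖ ≤ 1 * ‖e f‖ := fun f => by
    rw [one_mul]
    exact (hx.norm_av_le (h f)).trans (integral_norm_le_norm_toLp f)
  let L : Lp ℂ 2 μ →L[ℂ] ℂ := A.extendOfNorm e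
  have hL : ∀ f, L (e f) = A f := A.extendOfNorm_eq he ⟨1, hA⟩
  let φ : Lp ℂ 2 μ := (InnerProductSpace.toDual ℂ (Lp ℂ 2 μ)).symm L
  have hφ : ∀ g, inner ℂ φ g = L g := fun g => InnerProductSpace.toDual_symm_apply
  have hφ1 : ‖φ‖ ≤ 1 := by
    rw [LinearIsometryEquiv.norm_map]
    exact L.opNorm_le_bound zero_le_one (A.norm_extendOfNorm_apply_le he 1 hA)
  have hU : ∀ g, inner ℂ φ (koopman hT g) = ξ * inner ℂ φ g := by
    refine fun g => he.induction_on (p := fun g => inner ℂ φ (koopman hT g) = ξ * inner ℂ φ g) g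
      (isClosed_eq ?_ ?_) fun f => ?_
    · exact continuous_const.inner (continuous_koopman hT)
    · exact continuous_const.mul (continuous_const.inner continuous_id)
    · have h1 : koopman hT (e f) = e (f.comp (T : C(X, X))) := koopman_toLp hT f
      rw [h1, hφ, hφ, hL, hL]
      exact av_comp (h f)
  refine ⟨φ, hφ1, ?_, fun f => (hφ _).trans (hL f)⟩
  -- Expanding the square needs only that `U` is isometric and `⟪φ, U φ⟫ = ξ ‖φ‖²`, so the adjoint
  -- of `U` is not involved.
  have h0 : ‖koopman hT φ - (ξ : ℂ) • φ‖ ^ 2 = 0 := by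
    have h1 : inner ℂ ((ξ : ℂ) • φ) (koopman hT φ) = ((‖φ‖ ^ 2 : ℝ) : ℂ) := by
      rw [inner_smul_left, hU, ← mul_assoc, ← Circle.coe_inv_eq_conj, ← Circle.coe_mul,
        inv_mul_cancel, Circle.coe_one, one_mul, inner_self_eq_norm_sq_to_K]
      simp
    rw [norm_sub_rev, norm_sub_sq (𝕜 := ℂ), h1, norm_koopman, norm_smul, Circle.norm_coe,
      show RCLike.re ((‖φ‖ ^ 2 : ℝ) : ℂ) = ‖φ‖ ^ 2 from Complex.ofReal_re _]
    ring
  exact sub_eq_zero.1 (norm_eq_zero.1 (pow_eq_zero_iff two_ne_zero |>.1 h0))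

theorem ergodic_discrete_of_parseval (hT : MeasurePreserving T μ μ) {Ξ : Set Circle}
    (hx : IsGeneric T μ x) {D : Set C(X, ℂ)} (hD : Dense D)
    (hDex : ∀ f ∈ D, ∀ ξ ∈ Ξ, AvExists T f ξ x)
    (hDsum : ∀ f ∈ D,
      HasSum (fun ξ : Ξ => ‖av T f (ξ : Circle) x‖ ^ 2) (∫ y, ‖f y‖ ^ 2 ∂μ)) :
    Ergodic T μ ∧ HasDiscreteSpectrum hT ∧ spec hT ⊆ Ξ := by
  have hex : ∀ ξ : Ξ, ∀ f : C(X, ℂ), AvExists T f ξ x := fun ξ =>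
    avExists_of_dense hD fun f hf => hDex f hf ξ ξ.2
  choose φ hφ1 hφU hφ using fun ξ : Ξ => exists_koopman_eq_smul_inner_toLp hT hx (hex ξ)
  have horth : Pairwise fun i j => inner ℂ (φ i) (φ j) = 0 := fun i j hij =>
    inner_eq_zero_of_koopman_eq_smul hT (hφU i) (hφU j) (fun h => hij (Subtype.ext h))
  have hdense : Dense (Submodule.span ℂ (Set.range φ) : Set (Lp ℂ 2 μ)) := by
    rw [← dense_closure]
    refine (denseRange_toLp.dense_image (ContinuousMap.toLp (E := ℂ) 2 μ ℂ).continuous hD).mono ?_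
    rintro _ ⟨f, hf, rfl⟩
    refine mem_closure_span_of_hasSum horth hφ1 ?_
    simp only [hφ, norm_toLp_sq]
    exact hDsum f hf
  have hzero : ∀ g : Lp ℂ 2 μ, (∀ ξ, inner ℂ (φ ξ) g = 0) → g = 0 := fun g hg => by
    refine hdense.eq_zero_of_inner_right (𝕜 := ℂ) fun v hv => ?_
    induction hv using Submodule.span_induction with
    | mem y hy => obtain ⟨ξ, rfl⟩ := hy; exact hg ξ
    | zero => exact inner_zero_left _
    | add y z _ _ hy hz => rw [inner_add_left, hy, hz, add_zero]
    | smul c y _ hy => rw [inner_smul_left, hy, mul_zero]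
  have hspec : ∀ (ζ : Circle) (g : Lp ℂ 2 μ), koopman hT g = (ζ : ℂ) • g → ∀ ξ : Ξ,
      (ξ : Circle) ≠ ζ → inner ℂ (φ ξ) g = 0 := fun ζ g hg ξ hne =>
    inner_eq_zero_of_koopman_eq_smul hT (hφU ξ) hg hne
  refine ⟨?_, ?_, ?_⟩
  · by_cases h1 : (1 : Circle) ∈ Ξ
    · refine ergodic_of_invariant_eq_smul hT (ψ := φ ⟨1, h1⟩) fun u hu => ?_
      set ψ := φ ⟨1, h1⟩ with hψ
      -- The coefficient of the projection onto `ψ`. If `ψ = 0`, its value is irrelevant.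
      refine ⟨(inner ℂ ψ u) / (inner ℂ ψ ψ), sub_eq_zero.1 (hzero _ fun ξ => ?_)⟩
      by_cases hξ : (ξ : Circle) = 1
      · have : φ ξ = ψ := by rw [hψ]; congr 1; exact Subtype.ext hξ
        rw [this, inner_sub_right, inner_smul_right]
        by_cases h0 : ψ = 0
        · simp [h0]
        · rw [div_mul_cancel₀ _ (inner_self_ne_zero.2 h0), sub_self]
      · refine hspec 1 _ ?_ ξ hξ
        have hψU : koopman hT ψ = ((1 : Circle) : ℂ) • ψ := hφU ⟨1, h1⟩
        rw [map_sub, map_smul, hu, hψU]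
        simp
    -- With `1 ∉ Ξ`, an invariant function is orthogonal to every `φ ξ`, hence zero.
    · refine ergodic_of_invariant_eq_smul hT (ψ := 0) fun u hu => ⟨0, ?_⟩
      rw [zero_smul]
      exact hzero u fun ξ => hspec 1 u (by simpa using hu) ξ fun h => h1 (h ▸ ξ.2)
  · refine hdense.mono (Submodule.span_le.2 ?_)
    rintro _ ⟨ξ, rfl⟩
    by_cases h0 : φ ξ = 0
    · rw [h0]; exact Submodule.zero_mem _
    · exact Submodule.subset_span
        ⟨(ξ : Circle), Module.End.mem_eigenspace_iff.2 (hφU ξ), h0⟩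
  · intro ζ hζ
    obtain ⟨g, hg⟩ := Module.End.HasEigenvalue.exists_hasEigenvector hζ
    by_contra hne
    exact hg.2 (hzero g fun ξ => hspec ζ g hg.apply_eq_smul ξ fun h => hne (h ▸ ξ.2))

end Functional

/-! ### Eigenfunctions of ergodic systems. -/

section ErgodicEigen

variable {X : Type*} [MeasurableSpace X] {μ : Measure X} {T : X → X}

lemma kronecker_eq_top {hT : MeasurePreserving T μ μ} (hD : HasDiscreteSpectrum hT) :
    kronecker hT = ⊤ :=
  Submodule.dense_iff_topologicalClosure_eq_top.1 hD

lemma ae_comp_eq_of_koopman_eq_smul (hT : MeasurePreserving T μ μ) {g : Lp ℂ 2 μ} {c : ℂ}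
    (hg : koopman hT g = c • g) : ∀ᵐ y ∂μ, g (T y) = c * g y := by
  have h := coeFn_koopman hT g
  rw [hg] at h
  filter_upwards [h, Lp.coeFn_smul c g] with y h1 h2
  rw [h2] at h1
  exact h1.symm

lemma ae_iterate_eq_of_koopman_eq_smul (hT : MeasurePreserving T μ μ) {g : Lp ℂ 2 μ} {c : ℂ}
    (hg : koopman hT g = c • g) : ∀ᵐ y ∂μ, ∀ j : ℕ, g (T^[j] y) = c ^ j * g y := by
  have h : ∀ j : ℕ, ∀ᵐ y ∂μ, g (T (T^[j] y)) = c * g (T^[j] y) := fun j =>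
    (hT.iterate j).quasiMeasurePreserving.ae (ae_comp_eq_of_koopman_eq_smul hT hg)
  filter_upwards [ae_all_iff.2 h] with y hy j
  induction j with
  | zero => simp
  | succ j ih => rw [Function.iterate_succ_apply', hy, ih, pow_succ']; ring

/-- Since `|ξ| = 1`, the modulus is invariant, hence constant; for a probability measure that
constant is the L² norm. -/
lemma ae_norm_eq_of_koopman_eq_smul [IsProbabilityMeasure μ] (hE : Ergodic T μ)
    (hT : MeasurePreserving T μ μ) {g : Lp ℂ 2 μ} {ξ : Circle}
    (hg : koopman hT g = (ξ : ℂ) • g) : ∀ᵐ y ∂μ, ‖g y‖ = ‖g‖ := by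
  obtain ⟨c, hc⟩ := hE.ae_eq_const_of_ae_eq_comp_ae (g := fun y => ‖g y‖)
    (Lp.aestronglyMeasurable g).norm (by
      filter_upwards [ae_comp_eq_of_koopman_eq_smul hT hg] with y hy
      simp only [Function.comp, hy, norm_mul, Circle.norm_coe, one_mul])
  have hc' : ∀ᵐ y ∂μ, ‖g y‖ = c := hc
  have hc0 : 0 ≤ c := by
    obtain ⟨y, hy⟩ := hc'.exists
    exact hy ▸ norm_nonneg _
  have hn : ‖g‖ = c := by
    rw [Lp.norm_def, eLpNorm_congr_norm_ae (g := fun _ => c)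
      (hc'.mono fun y hy => by rw [hy, Real.norm_of_nonneg hc0])]
    rw [eLpNorm_const' c two_ne_zero ENNReal.ofNat_ne_top]
    simp [hc0]
  rwa [hn]

/-- Simplicity of eigenvalues: `g * star φ` is invariant, hence constant, and `φ` is unimodular. -/
lemma eq_smul_of_koopman_eq_smul (hE : Ergodic T μ)
    (hT : MeasurePreserving T μ μ) {g φ : Lp ℂ 2 μ} {ξ : Circle}
    (hg : koopman hT g = (ξ : ℂ) • g) (hφ : koopman hT φ = (ξ : ℂ) • φ)
    (hφ1 : ∀ᵐ y ∂μ, ‖φ y‖ = 1) : ∃ c : ℂ, g = c • φ := by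
  obtain ⟨c, hc⟩ := hE.ae_eq_const_of_ae_eq_comp_ae (g := fun y => g y * star (φ y))
    ((Lp.aestronglyMeasurable g).mul (Lp.aestronglyMeasurable φ).star) (by
      filter_upwards [ae_comp_eq_of_koopman_eq_smul hT hg,
        ae_comp_eq_of_koopman_eq_smul hT hφ] with y h1 h2
      have h3 : (ξ : ℂ) * star (ξ : ℂ) = 1 := by
        rw [Complex.star_def, Complex.mul_conj, Circle.normSq_coe, Complex.ofReal_one]
      simp only [Function.comp, h1, h2, star_mul']
      linear_combination (g y * star (φ y)) * h3)
  refine ⟨c, Lp.ext ?_⟩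
  filter_upwards [hc, hφ1, Lp.coeFn_smul c φ] with y h1 h2 h3
  have h4 : φ y * star (φ y) = 1 := by
    rw [Complex.star_def, Complex.mul_conj, Complex.normSq_eq_norm_sq, h2]
    simp
  simp only [Function.const] at h1
  rw [h3, Pi.smul_apply, smul_eq_mul]
  linear_combination φ y * h1 - g y * h4

/-- For an ergodic system with discrete spectrum there is an orthonormal basis of unimodular
eigenfunctions indexed by the spectrum. -/
theorem exists_eigenbasis [IsProbabilityMeasure μ] (hE : Ergodic T μ)
    (hT : MeasurePreserving T μ μ) (hD : HasDiscreteSpectrum hT) :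
    ∃ φ : HilbertBasis (spec hT) ℂ (Lp ℂ 2 μ),
      (∀ ξ, koopman hT (φ ξ) = ((ξ : Circle) : ℂ) • φ ξ) ∧ ∀ ξ, ∀ᵐ y ∂μ, ‖φ ξ y‖ = 1 := by
  have hex : ∀ ξ : spec hT, ∃ g : Lp ℂ 2 μ, koopman hT g = ((ξ : Circle) : ℂ) • g ∧ ‖g‖ = 1 := by
    intro ξ
    obtain ⟨g, hg⟩ := Module.End.HasEigenvalue.exists_hasEigenvector ξ.2
    refine ⟨((‖g‖⁻¹ : ℝ) : ℂ) • g, ?_, ?_⟩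
    · rw [map_smul, hg.apply_eq_smul, smul_comm]
    · rw [norm_smul, Complex.norm_real, norm_inv, norm_norm,
        inv_mul_cancel₀ (norm_ne_zero_iff.2 hg.2)]
  choose φ hφU hφn using hex
  have hφ1 : ∀ ξ, ∀ᵐ y ∂μ, ‖φ ξ y‖ = 1 := fun ξ => by
    have := ae_norm_eq_of_koopman_eq_smul hE hT (hφU ξ)
    rwa [hφn] at this
  have hon : Orthonormal ℂ φ := ⟨hφn, fun i j hij =>
    inner_eq_zero_of_koopman_eq_smul hT (hφU i) (hφU j) (fun h => hij (Subtype.ext h))⟩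
  have hspan : eigenSpan hT ≤ Submodule.span ℂ (Set.range φ) := by
    refine Submodule.span_le.2 ?_
    rintro g ⟨c, hc⟩
    have hcU := hc.apply_eq_smul
    let ξ : Circle :=
      ⟨c, mem_sphere_zero_iff_norm.2 (norm_eq_one_of_koopman_eq_smul hT hcU hc.2)⟩
    have hξ : ξ ∈ spec hT := Module.End.hasEigenvalue_of_hasEigenvector hc
    obtain ⟨a, ha⟩ := eq_smul_of_koopman_eq_smul hE hT (ξ := ξ) hcU (hφU ⟨ξ, hξ⟩) (hφ1 _)
    rw [ha]
    exact Submodule.smul_mem _ _ (Submodule.subset_span (Set.mem_range_self _))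
  have hdense : ⊤ ≤ (Submodule.span ℂ (Set.range φ)).topologicalClosure := by
    have h := Submodule.dense_iff_topologicalClosure_eq_top.1 (hD.mono hspan)
    exact h.ge
  refine ⟨HilbertBasis.mk hon hdense, ?_, ?_⟩
  · simpa using hφU
  · simpa using hφ1

end ErgodicEigen

/-- Orthonormal vectors lie at distance `√2`, so balls of radius `1/2` about them are disjoint.
Countability of the spectrum allows almost-everywhere statements to be intersected over it. -/
lemma _root_.Orthonormal.countable_of_separableSpace {ι E : Type*} [NormedAddCommGroup E]
    [InnerProductSpace ℂ E] [TopologicalSpace.SeparableSpace E] {φ : ι → E}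
    (hφ : Orthonormal ℂ φ) : Countable ι := by
  refine Pairwise.countable_of_isOpen_disjoint (s := fun i => Metric.ball (φ i) (1 / 2)) ?_
    (fun _ => Metric.isOpen_ball) fun _ => Metric.nonempty_ball.2 (by norm_num)
  intro i j hij
  refine Metric.ball_disjoint_ball ?_
  have h : ‖φ i - φ j‖ ^ 2 = 2 := by
    rw [norm_sub_sq (𝕜 := ℂ), hφ.2 hij, hφ.1 i, hφ.1 j]
    norm_num
  rw [dist_eq_norm]
  nlinarith [norm_nonneg (φ i - φ j)]

/-! ### Limits at typical points, regularity and frequencies. -/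

section Pointwise

variable {X : Type*} [MetricSpace X] [CompactSpace X] [MeasurableSpace X] [BorelSpace X]
  {T : X ≃ₜ X} {μ : Measure X} [IsProbabilityMeasure μ]

lemma integral_norm_sub_sum_le {ι : Type*} (φ : ι → Lp ℂ 2 μ) (c : ι → ℂ) (f : C(X, ℂ))
    (F : Finset ι) :
    ∫ y, ‖f y - ∑ i ∈ F, c i * φ i y‖ ∂μ ≤
      ‖ContinuousMap.toLp (E := ℂ) 2 μ ℂ f - ∑ i ∈ F, c i • φ i‖ := by
  refine le_trans (le_of_eq (integral_congr_ae ?_)) (integral_norm_le_norm_Lp _)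
  have h : ∀ᵐ y ∂μ, ∀ i ∈ F, (c i • φ i : Lp ℂ 2 μ) y = c i * φ i y :=
    (Finset.eventually_all F).2 fun i _ => Lp.coeFn_smul (c i) (φ i)
  filter_upwards [Lp.coeFn_sub (ContinuousMap.toLp (E := ℂ) 2 μ ℂ f) (∑ i ∈ F, c i • φ i),
    ContinuousMap.coeFn_toLp (p := 2) (𝕜 := ℂ) μ f,
    Lp.coeFn_finsetSum F (fun i => c i • φ i), h] with y h1 h2 h3 h4
  rw [h1, Pi.sub_apply, h2, h3, Finset.sum_apply, Finset.sum_congr rfl h4]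

lemma _root_.Ergodic.ae_eventually_birkhoffAverage_norm_sub_sum_le {ι : Type*}
    (hE : Ergodic T μ) (φ : ι → Lp ℂ 2 μ) (c : ι → ℂ) (f : C(X, ℂ)) (F : Finset ι) :
    ∀ᵐ x ∂μ, ∀ a : ℝ, ‖ContinuousMap.toLp (E := ℂ) 2 μ ℂ f - ∑ i ∈ F, c i • φ i‖ < a →
      ∀ᶠ n in atTop, birkhoffAverage ℝ T (fun y => ‖f y - ∑ i ∈ F, c i * φ i y‖) n x ≤ a := by
  have hm : Measurable fun y => ‖f y - ∑ i ∈ F, c i * φ i y‖ := by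
    refine (f.continuous.measurable.sub (Finset.measurable_sum _ fun i _ => ?_)).norm
    exact (Lp.stronglyMeasurable (φ i)).measurable.const_mul _
  have hi : Integrable (fun y => ‖f y - ∑ i ∈ F, c i * φ i y‖) μ := by
    refine (Integrable.sub ?_ (integrable_finsetSum _ fun i _ => ?_)).norm
    · exact (ContinuousMap.memLp μ ℂ f (p := 1)).integrable le_rfl
    · exact ((Lp.memLp (φ i)).integrable (by norm_num)).const_mul _
  filter_upwards [hE.ae_eventually_birkhoffAverage_le hm hi] with x hx a ha
  exact hx a ((integral_norm_sub_sum_le φ c f F).trans_lt ha)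

open Classical in
/-- The limit of the weighted averages of `f` at a typical point `x` of an ergodic system with
discrete spectrum, in terms of an orthonormal basis `φ` of eigenfunctions. -/
noncomputable def eigenCoeff {S : Set Circle} (φ : S → Lp ℂ 2 μ) (f : C(X, ℂ)) (ξ : Circle)
    (x : X) : ℂ :=
  if h : ξ ∈ S then inner ℂ (φ ⟨ξ, h⟩) (ContinuousMap.toLp (E := ℂ) 2 μ ℂ f) * φ ⟨ξ, h⟩ x else 0

lemma norm_eigenCoeff_sub_le {S : Set Circle} {φ : S → Lp ℂ 2 μ} (hφ : ∀ i, ‖φ i‖ = 1)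
    {x : X} (hx : ∀ i, ‖φ i x‖ = 1) (f g : C(X, ℂ)) (ξ : Circle) :
    ‖eigenCoeff φ f ξ x - eigenCoeff φ g ξ x‖ ≤
      ‖ContinuousMap.toLp (E := ℂ) 2 μ ℂ f - ContinuousMap.toLp (E := ℂ) 2 μ ℂ g‖ := by
  by_cases h : ξ ∈ S
  · simp only [eigenCoeff, h, dite_true]
    rw [← sub_mul, ← inner_sub_right, norm_mul, hx, mul_one]
    exact (norm_inner_le_norm _ _).trans_eq (by rw [hφ, one_mul])
  · simp [eigenCoeff, h]

open Classical in
lemma eventually_sum_ite_eq_eigenCoeff {S : Set Circle} (φ : S → Lp ℂ 2 μ) (f : C(X, ℂ))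
    (ξ : Circle) (x : X) : ∀ᶠ F : Finset S in atTop,
      ∑ i ∈ F, inner ℂ (φ i) (ContinuousMap.toLp (E := ℂ) 2 μ ℂ f) *
        (if (i : Circle) = ξ then φ i x else 0) = eigenCoeff φ f ξ x := by
  by_cases h : ξ ∈ S
  · filter_upwards [eventually_ge_atTop ({⟨ξ, h⟩} : Finset S)] with F hF
    rw [Finset.sum_eq_single_of_mem (⟨ξ, h⟩ : S) (hF (Finset.mem_singleton_self _))]
    · simp [eigenCoeff, h]
    · intro i _ hi
      rw [if_neg fun h' => hi (Subtype.ext h'), mul_zero]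
  · refine Eventually.of_forall fun F => ?_
    rw [Finset.sum_eq_zero, eigenCoeff, dif_neg h]
    intro i _
    rw [if_neg fun h' : (i : Circle) = ξ => h (h' ▸ i.2), mul_zero]

theorem ae_tendsto_avg_eigenCoeff (hE : Ergodic T μ) (hT : MeasurePreserving T μ μ)
    (φ : HilbertBasis (spec hT) ℂ (Lp ℂ 2 μ))
    (hφU : ∀ ξ, koopman hT (φ ξ) = ((ξ : Circle) : ℂ) • φ ξ)
    (hφ1 : ∀ ξ, ∀ᵐ y ∂μ, ‖φ ξ y‖ = 1) :
    ∀ᵐ x ∂μ, ∀ (f : C(X, ℂ)) (ξ : Circle),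
      Tendsto (avg T f ξ x) atTop (𝓝 (eigenCoeff φ f ξ x)) := by
  classical
  have : TopologicalSpace.SeparableSpace (Lp ℂ 2 μ) :=
    (denseRange_toLp (μ := μ)).separableSpace (ContinuousMap.toLp (E := ℂ) 2 μ ℂ).continuous
  have hcount : Countable (spec hT) := φ.orthonormal.countable_of_separableSpace
  let d := TopologicalSpace.denseSeq C(X, ℂ)
  have hd : DenseRange d := TopologicalSpace.denseRange_denseSeq _
  -- The null set is fixed over the countably many pairs `(k, F)`, before `f` and `ξ` are chosen.
  have hB := ae_all_iff.2 fun k => ae_all_iff.2 fun F : Finset (spec hT) =>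
    hE.ae_eventually_birkhoffAverage_norm_sub_sum_le φ
      (fun i => inner ℂ (φ i) (ContinuousMap.toLp (E := ℂ) 2 μ ℂ (d k))) (d k) F
  filter_upwards [hB, ae_all_iff.2 hφ1,
    ae_all_iff.2 fun ξ => ae_iterate_eq_of_koopman_eq_smul hT (hφU ξ)] with x hxB hx1 hxU f ξ
  have hseq : ∀ k, Tendsto (avg T (d k) ξ x) atTop (𝓝 (eigenCoeff φ (d k) ξ x)) := by
    intro k
    refine tendsto_wavg_of_approx fun ε hε => ?_
    have hsum := φ.hasSum_repr (ContinuousMap.toLp (E := ℂ) 2 μ ℂ (d k))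
    simp only [φ.repr_apply_apply] at hsum
    -- `F` is large enough both to contain `ξ` when it is an eigenvalue and to approximate `d k`
    -- within `ε` in L².
    obtain ⟨F, hF1, hF2⟩ := ((eventually_sum_ite_eq_eigenCoeff φ (d k) ξ x).and
      (Metric.tendsto_nhds.1 hsum ε hε)).exists
    rw [dist_comm, dist_eq_norm] at hF2
    refine ⟨_, eigenCoeff φ (d k) ξ x, ?_, ?_, hxB k F ε hF2⟩
    · rw [← hF1]
      refine (tendsto_finsetSum F fun i _ =>
        (tendsto_wavg_of_eigen (ξ := ξ) (hxU i)).const_mul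
          (inner ℂ (φ i) (ContinuousMap.toLp (E := ℂ) 2 μ ℂ (d k)))).congr fun n => ?_
      rw [wavg_sum]
      exact Finset.sum_congr rfl fun i _ => (wavg_const_mul _ _ _ _ _ _).symm
    · simpa using hε.le
  refine tendsto_wavg_of_approx fun ε hε => ?_
  have h1 : IsOpen {g : C(X, ℂ) | dist f g < ε} :=
    isOpen_lt (continuous_const.dist continuous_id) continuous_const
  have h2 : IsOpen {g : C(X, ℂ) | dist (ContinuousMap.toLp (E := ℂ) 2 μ ℂ g)
      (ContinuousMap.toLp (E := ℂ) 2 μ ℂ f) < ε} :=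
    isOpen_lt ((ContinuousMap.toLp (E := ℂ) 2 μ ℂ).continuous.dist continuous_const)
      continuous_const
  -- Closeness in sup norm controls the averages; closeness in L² controls the limits.
  obtain ⟨k, hk1, hk2⟩ := hd.exists_mem_open (h1.inter h2) ⟨f, by simpa using hε⟩
  simp only [Set.mem_ofPred_eq] at hk1 hk2
  refine ⟨d k, _, hseq k, ?_, Eventually.of_forall fun n => ?_⟩
  · rw [dist_eq_norm] at hk2
    exact (norm_eigenCoeff_sub_le φ.orthonormal.1 hx1 _ _ ξ).trans hk2.le
  · refine birkhoffAverage_le_of_le _ _ hε.le (fun y => ?_) n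
    rw [← dist_eq_norm]
    exact (ContinuousMap.dist_apply_le_dist y).trans hk1.le

/-- By simplicity the basis vector at eigenvalue 1 is a unimodular constant, whose phase cancels.
This yields genericity. -/
lemma ae_eigenCoeff_one (hE : Ergodic T μ) (hT : MeasurePreserving T μ μ)
    {φ : spec hT → Lp ℂ 2 μ} (hφU : ∀ ξ, koopman hT (φ ξ) = ((ξ : Circle) : ℂ) • φ ξ)
    (hφ1 : ∀ ξ, ∀ᵐ y ∂μ, ‖φ ξ y‖ = 1) :
    ∀ᵐ x ∂μ, ∀ f : C(X, ℂ), eigenCoeff φ f 1 x = ∫ y, f y ∂μ := by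
  let e : Lp ℂ 2 μ := ContinuousMap.toLp (E := ℂ) 2 μ ℂ 1
  have he : ∀ᵐ y ∂μ, e y = 1 := by
    filter_upwards [ContinuousMap.coeFn_toLp (p := 2) (𝕜 := ℂ) μ (1 : C(X, ℂ))] with y hy
    rw [hy, ContinuousMap.one_apply]
  have heU : koopman hT e = ((1 : Circle) : ℂ) • e := by
    rw [Circle.coe_one, one_smul, koopman_toLp]
    rfl
  have he0 : e ≠ 0 := by
    intro h0
    obtain ⟨y, hy1, hy2⟩ := (he.and (Lp.coeFn_zero ℂ 2 μ)).exists
    rw [h0, hy2] at hy1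
    simp at hy1
  have h1 : (1 : Circle) ∈ spec hT :=
    Module.End.hasEigenvalue_of_hasEigenvector ⟨Module.End.mem_eigenspace_iff.2 heU, he0⟩
  obtain ⟨c, hc⟩ := eq_smul_of_koopman_eq_smul hE hT (hφU ⟨1, h1⟩) heU
    (he.mono fun y hy => by rw [hy, norm_one])
  filter_upwards [he, hφ1 ⟨1, h1⟩, Lp.coeFn_smul c e] with x hx1 hx2 hx3 f
  have hφx : φ ⟨1, h1⟩ x = c := by rw [hc, hx3, Pi.smul_apply, hx1, smul_eq_mul, mul_one]
  rw [hφx] at hx2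
  have hcc : (starRingEnd ℂ) c * c = 1 := by
    rw [mul_comm, Complex.mul_conj, Complex.normSq_eq_norm_sq, hx2]
    simp
  have hint : inner ℂ e (ContinuousMap.toLp (E := ℂ) 2 μ ℂ f) = ∫ y, f y ∂μ := by
    rw [ContinuousMap.inner_toLp]
    simp
  rw [eigenCoeff, dif_pos h1, hφx, hc, inner_smul_left, hint]
  linear_combination (∫ y, f y ∂μ) * hcc

/-- Almost every point of an ergodic system with discrete spectrum is a regular Wiener--Wintner
generic point, and Parseval's identity holds there over every set containing the spectrum. -/
theorem ae_isRegularWWGeneric (hE : Ergodic T μ) (hT : MeasurePreserving T μ μ)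
    (hD : HasDiscreteSpectrum hT) :
    ∀ᵐ x ∂μ, IsRegularWWGeneric T μ hT x ∧ ∀ Ξ : Set Circle, spec hT ⊆ Ξ →
      ∀ f : C(X, ℂ), HasSum (fun ξ : Ξ => ‖av T f (ξ : Circle) x‖ ^ 2) (∫ y, ‖f y‖ ^ 2 ∂μ) := by
  obtain ⟨φ, hφU, hφ1⟩ := exists_eigenbasis hE hT hD
  have : TopologicalSpace.SeparableSpace (Lp ℂ 2 μ) :=
    (denseRange_toLp (μ := μ)).separableSpace (ContinuousMap.toLp (E := ℂ) 2 μ ℂ).continuous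
  have hcount : Countable (spec hT) := φ.orthonormal.countable_of_separableSpace
  filter_upwards [ae_tendsto_avg_eigenCoeff hE hT φ hφU hφ1, ae_eigenCoeff_one hE hT hφU hφ1,
    ae_all_iff.2 hφ1] with x hx hx1 hxn
  have hex : ∀ (f : C(X, ℂ)) (ξ : Circle), AvExists T f ξ x := fun f ξ => ⟨_, hx f ξ⟩
  have hav : ∀ (f : C(X, ℂ)) (ξ : Circle), av T f ξ x = eigenCoeff φ f ξ x := fun f ξ =>
    (hx f ξ).limUnder_eq
  have hgen : IsGeneric T μ x := fun f => by
    rw [← hx1 f]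
    exact (hx f 1).congr fun n => avg_one f x n
  have hsumS : ∀ f : C(X, ℂ), HasSum (fun ξ : spec hT => ‖av T f (ξ : Circle) x‖ ^ 2)
      (∫ y, ‖f y‖ ^ 2 ∂μ) := fun f => by
    have h := φ.hasSum_inner_mul_inner (ContinuousMap.toLp (E := ℂ) 2 μ ℂ f)
      (ContinuousMap.toLp (E := ℂ) 2 μ ℂ f)
    rw [inner_self_eq_norm_sq_to_K] at h
    rw [← norm_toLp_sq, ← Complex.hasSum_ofReal]
    convert! h using 1
    · ext ξ
      rw [hav, eigenCoeff, dif_pos ξ.2, norm_mul, hxn, mul_one,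
        ← inner_conj_symm (ContinuousMap.toLp (E := ℂ) 2 μ ℂ f), mul_comm,
        Complex.mul_conj, Complex.normSq_eq_norm_sq]
    · simp
  have hsum : ∀ f : C(X, ℂ), HasSum (fun ξ : Circle => ‖av T f ξ x‖ ^ 2)
      (∫ y, ‖f y‖ ^ 2 ∂μ) := fun f => by
    refine (hasSum_subtype_iff_of_support_subset fun ξ hξ => ?_).1 (hsumS f)
    by_contra hne
    exact hξ (by simp [hav, eigenCoeff, hne])
  refine ⟨⟨⟨hgen, hex⟩, fun f => ?_⟩, fun Ξ hΞ f => ?_⟩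
  · simp only [kronecker_eq_top hD, Submodule.starProjection_top, ContinuousLinearMap.id_apply,
      norm_toLp_sq]
    refine (hasSum_subtype_iff_of_support_subset fun ξ hξ => ?_).2 (hsum f)
    exact (mem_freq_iff fun g => hex g ξ).2 ⟨f, fun h => hξ (by simp [h])⟩
  · refine (hasSum_subtype_iff_of_support_subset fun ξ hξ => hΞ ?_).2 (hsum f)
    by_contra hne
    exact hξ (by simp [hav, eigenCoeff, hne])

/-- The sum over `Ξ` is already `‖f‖²`, while by regularity the sum over the whole circle is `‖P f‖²
≤ ‖f‖²`. A frequency outside `Ξ` would add a positive term for some `f`. -/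
lemma freq_subset_of_parseval {hT : MeasurePreserving T μ μ} {x : X} {Ξ : Set Circle}
    (hx : IsRegularWWGeneric T μ hT x) (hsum : ∀ f : C(X, ℂ),
      HasSum (fun ξ : Ξ => ‖av T f (ξ : Circle) x‖ ^ 2) (∫ y, ‖f y‖ ^ 2 ∂μ)) :
    freq T x ⊆ Ξ := by
  intro ξ hξ
  by_contra hne
  obtain ⟨f, hf⟩ := (mem_freq_iff fun g => hx.1.2 g ξ).1 hξ
  have hall : HasSum (fun ζ : Circle => ‖av T f ζ x‖ ^ 2)
      (‖(kronecker hT).starProjection (ContinuousMap.toLp (E := ℂ) 2 μ ℂ f)‖ ^ 2) := by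
    refine (hasSum_subtype_iff_of_support_subset fun ζ hζ => ?_).1 (hx.2 f)
    exact (mem_freq_iff fun g => hx.1.2 g ζ).2 ⟨f, fun h => hζ (by simp [h])⟩
  have hle : ‖(kronecker hT).starProjection (ContinuousMap.toLp (E := ℂ) 2 μ ℂ f)‖ ^ 2 ≤
      ∫ y, ‖f y‖ ^ 2 ∂μ := by
    rw [← norm_toLp_sq]
    exact pow_le_pow_left₀ (norm_nonneg _) ((kronecker hT).norm_starProjection_apply_le _) 2
  have hΞ : HasSum (Ξ.indicator fun ζ : Circle => ‖av T f ζ x‖ ^ 2) (∫ y, ‖f y‖ ^ 2 ∂μ) :=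
    hasSum_subtype_iff_indicator.1 (hsum f)
  have hlt := hasSum_lt (i := ξ) (fun ζ => Set.indicator_le_self' (fun _ _ => by positivity) ζ)
    (by rw [Set.indicator_of_notMem hne]; positivity) hΞ hall
  exact absurd hle (not_le.2 hlt)

end Pointwise

end WienerWintner

/-! ### The equivalence. -/

open WienerWintner
theorem mainTheorem4 {X : Type*} [MetricSpace X] [CompactSpace X] [MeasurableSpace X]
    [BorelSpace X] (T : X ≃ₜ X) (μ : Measure X) [IsProbabilityMeasure μ]
    (hT : MeasurePreserving T μ μ) (Ξ : Set Circle) :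
    List.TFAE [
      Ergodic T μ ∧ HasDiscreteSpectrum hT ∧ spec hT ⊆ Ξ,
      ∃ X' : Set X, MeasurableSet X' ∧ μ X' = 1 ∧ ∀ x ∈ X', IsRegularWWGeneric T μ hT x ∧
        ∀ f : C(X, ℂ), HasSum (fun ξ : Ξ => ‖av T f (ξ : Circle) x‖ ^ 2) (∫ y, ‖f y‖ ^ 2 ∂μ),
      ∃ x : X, IsGeneric T μ x ∧ ∃ D : Set C(X, ℂ), D.Countable ∧ Dense D ∧
        ∀ f ∈ D, (∀ ξ ∈ Ξ, AvExists T f ξ x) ∧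
          HasSum (fun ξ : Ξ => ‖av T f (ξ : Circle) x‖ ^ 2) (∫ y, ‖f y‖ ^ 2 ∂μ),
      ∃ x : X, IsRegularWWGeneric T μ hT x ∧
        (∀ f : C(X, ℂ),
          HasSum (fun ξ : Ξ => ‖av T f (ξ : Circle) x‖ ^ 2) (∫ y, ‖f y‖ ^ 2 ∂μ)) ∧
        freq T x ⊆ Ξ] := by
  tfae_have 1 → 2 := by
    rintro ⟨hE, hD, hspec⟩
    have hae := ae_isRegularWWGeneric hE hT hD
    rw [ae_iff] at hae
    -- The good set need not be Borel, so `X'` is the complement of a measurable hull of the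
    -- exceptional set.
    refine ⟨_, (measurableSet_toMeasurable μ _).compl,
      (prob_compl_eq_one_iff (measurableSet_toMeasurable μ _)).2
        ((measure_toMeasurable _).trans hae), fun x hx => ?_⟩
    have hx' := not_not.1 fun h => hx (subset_toMeasurable μ _ h)
    exact ⟨hx'.1, hx'.2 Ξ hspec⟩
  tfae_have 2 → 4 := by
    rintro ⟨X', -, hX', h⟩
    obtain ⟨x, hx⟩ : X'.Nonempty := nonempty_of_measure_ne_zero (by rw [hX']; exact one_ne_zero)
    exact ⟨x, (h x hx).1, (h x hx).2, freq_subset_of_parseval (h x hx).1 (h x hx).2⟩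
  tfae_have 4 → 3 := by
    rintro ⟨x, hx, hsum, -⟩
    obtain ⟨D, hDc, hD⟩ := TopologicalSpace.exists_countable_dense C(X, ℂ)
    exact ⟨x, hx.1.1, D, hDc, hD, fun f _ => ⟨fun ξ _ => hx.1.2 f ξ, hsum f⟩⟩
  tfae_have 3 → 1 := by
    rintro ⟨x, hx, D, -, hD, h⟩
    exact ergodic_discrete_of_parseval hT hx hD (fun f hf => (h f hf).1) fun f hf => (h f hf).2
  tfae_finish
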